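/- Let $\delta\ge 2$ be an integer. For integers $n\ge 0$ let $P_n^{(a,b)}$ denote the Jacobi polynomials (standard normalization $P_n^{(a,b)}(1)=\Gamma(n+a+1)/(n!\,\Gamma(a+1))$), and put \[ \omega_n = 2n+\delta,\qquad \mathsf N_n=\sqrt{\frac{2\,\Gamma(n+1)}{\Gamma\left(n+\frac32\right)}\,\frac{(2n+\delta)\,\Gamma(n+\delta)}{\Gamma\left(n+\delta-\frac12\right)}},\qquad e_n(x)=\mathsf N_n\,P_n^{\left(\frac12,\,\delta-\frac32\right)}(\cos 2x). \] These are the frequencies and the normalized eigenfunctions of the linearized operator of the cubic Klein--Gordon (KG) model with conformal mass $\delta$ on $(0,\pi/2)$, with measure $d\mu(x)=\sin^2(x)\cos^{2\delta-2}(x)\,dx$ and nonlinearity coefficient $W(x)=\cos^{2\delta-2}(x)$. Define the Fourier coefficients \[ \mathsf C_{ijkm}=\int_0^{\pi/2} W(x)\,e_i(x)\,e_j(x)\,e_k(x)\,e_m(x)\,d\mu(x), \qquad \mathsf f_m=\frac{\mathsf C_{00mm}}{\omega_m^2}. \] Then the following hold. (1) For every integer $m\ge 1$, \[ \mathsf P_m\,\mathsf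 f_m-\mathsf Q_m\,\mathsf f_{m+1}+\mathsf R_m\,\mathsf f_{m+2}=0, \] where \begin{align*} \mathsf{P}_m &=2 (m+1)^2 (2 m+1) (2 m+3) (\delta +m) (\delta +2 m) (\delta +2 m+3) (2 \delta +2 m-1) \big(9 \delta +4 m^2 \\ &+4 \delta m+12 m+7\big) , \\ \mathsf{Q}_m & =(\delta +2 m+2)^2 \big(315 \delta ^5+728 \delta ^4+914 \delta ^3+418 \delta ^2-41 \delta +832 \delta ^2 m^6+704 \delta ^3 m^5 \\ &+5760 \delta ^2 m^5+320 \delta ^4 m^4+4432 \delta ^3 m^4+15432 \delta ^2 m^4+64 \delta ^5 m^3+1824 \delta ^4 m^3+10352 \delta ^3 m^3 \\ &+20224 \delta ^2 m^3 +336 \delta ^5 m^2+3620 \delta ^4 m^2+11064 \delta ^3 m^2+13402 \delta ^2 m^2+512 \delta m^7+3840 \delta m^6 \\ &+11424 \delta m^5+17168 \delta m^4+13616 \delta m^3+5280 \delta m^2+128 m^8+1024 m^7+3296 m^6+5440 m^5 \\ &+4792 m^4+2016 m^3+154 m^2+572 \delta ^5 m+2880 \delta ^4 m+5330 \delta ^3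 m+4100 \delta ^2 m+698 \delta m \\ &-140 m-30\big) , \\ \mathsf{R}_m &= 2 (m+2) (2 m+5) (\delta +m+1)^2 (\delta +2 m+1) (\delta +2 m+4) (2 \delta +2 m+1) (2 \delta +2 m+3)\cdot \\ &~\cdot\big(5 \delta +4 m^2+4 \delta m+4 m-1\big) . \end{align*} (2) The sequence $(\mathsf f_m)_{m\ge 1}$ is strictly decreasing in $m$. -/

import Mathlib

/-- The Jacobi polynomial `P_n^{(a,b)}(y)`, in the standard normalization
`P_n^{(a,b)}(1) = (a+1)_n / n!`, written out in powers of `(y-1)/2`: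
`∑_{l ≤ n} (n+a+b+1)_l (a+l+1)_{n-l} / (l! (n-l)!) ((y-1)/2)^l`,
where `(z)_k = z (z+1) ⋯ (z+k-1)`. -/
noncomputable def jacobiP (a b : ℝ) (n : ℕ) (y : ℝ) : ℝ :=
  ∑ l ∈ Finset.range (n + 1),
    (ascPochhammer ℝ l).eval ((n : ℝ) + a + b + 1) *
      (ascPochhammer ℝ (n - l)).eval (a + (l : ℝ) + 1) /
      ((l.factorial : ℝ) * ((n - l).factorial : ℝ)) * ((y - 1) / 2) ^ l

/-- The frequencies `ω_n = 2n + δ`; their squares are the eigenvalues of the linearized operator. -/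
def kgOmega (δ : ℝ) (n : ℕ) : ℝ := 2 * (n : ℝ) + δ

/-- The normalization constants `N_n` of the eigenfunctions. -/
noncomputable def kgN (δ : ℝ) (n : ℕ) : ℝ :=
  Real.sqrt (2 * Real.Gamma ((n : ℝ) + 1) / Real.Gamma ((n : ℝ) + 3 / 2) *
    ((2 * (n : ℝ) + δ) * Real.Gamma ((n : ℝ) + δ) / Real.Gamma ((n : ℝ) + δ - 1 / 2)))

/-- The eigenfunctions `e_n(x) = N_n P_n^{(1/2, δ-3/2)}(cos 2x)` on `(0, π/2)`. -/
noncomputable def kgE (δ : ℝ) (n : ℕ) (x : ℝ) : ℝ :=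
  kgN δ n * jacobiP (1 / 2) (δ - 3 / 2) n (Real.cos (2 * x))

/-- The coefficient `W(x) = cos^{2δ-2}(x)` of the cubic nonlinearity. -/
noncomputable def kgW (δ x : ℝ) : ℝ := Real.cos x ^ (2 * δ - 2)

/-- The density `w(x) = sin²(x) cos^{2δ-2}(x)` of the measure `dμ = w dx` on `(0, π/2)`. -/
noncomputable def kgWeight (δ x : ℝ) : ℝ := Real.sin x ^ 2 * Real.cos x ^ (2 * δ - 2)

/-- The Fourier coefficients `C_{ijkm} = (W e_i e_j e_k | e_m) = ∫ W e_i e_j e_k e_m dμ`. -/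
noncomputable def kgC (δ : ℝ) (i j k m : ℕ) : ℝ :=
  ∫ x in (0 : ℝ)..(Real.pi / 2),
    kgW δ x * kgE δ i x * kgE δ j x * kgE δ k x * kgE δ m x * kgWeight δ x

/-- The sequence `f_m = C_{00mm} / ω_m²`. -/
noncomputable def kgF (δ : ℝ) (m : ℕ) : ℝ := kgC δ 0 0 m m / kgOmega δ m ^ 2

/-- The coefficient `P_m` of the recurrence relation. -/
def kgRecP (δ m : ℝ) : ℝ :=
    2 * (m+1)^2 * (2 * m+1) * (2 * m+3) * (δ + m) * (δ + 2 * m) * (δ + 2 * m+3) * (2 * δ + 2 *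
    m-1) * (9 * δ + 4 * m^2 + 4 * δ * m+12 * m+7)

/-- The coefficient `Q_m` of the recurrence relation. -/
def kgRecQ (δ m : ℝ) : ℝ :=
    (δ + 2 * m+2)^2 * (315 * δ^5+728 * δ^4+914 * δ^3+418 * δ^2-41 * δ + 832 * δ^2 * m^6+704 *
    δ^3 * m^5 + 5760 * δ^2 * m^5+320 * δ^4 * m^4+4432 * δ^3 * m^4+15432 * δ^2 * m^4+64 * δ^5 *
    m^3+1824 * δ^4 * m^3+10352 * δ^3 * m^3 + 20224 * δ^2 * m^3 + 336 * δ^5 * m^2+3620 * δ^4 *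
    m^2+11064 * δ^3 * m^2+13402 * δ^2 * m^2+512 * δ * m^7+3840 * δ * m^6 + 11424 * δ * m^5+17168
    * δ * m^4+13616 * δ * m^3+5280 * δ * m^2+128 * m^8+1024 * m^7+3296 * m^6+5440 * m^5 + 4792 *
    m^4+2016 * m^3+154 * m^2+572 * δ^5 * m+2880 * δ^4 * m+5330 * δ^3 * m+4100 * δ^2 * m+698 * δ
    * m - 140 * m-30)

/-- The coefficient `R_m` of the recurrence relation. -/
def kgRecR (δ m : ℝ) : ℝ :=
    2 * (m+2) * (2 * m+5) * (δ + m+1)^2 * (δ + 2 * m+1) * (δ + 2 * m+4) * (2 * δ + 2 * m+1) * (2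
    * δ + 2 * m+3) * (5 * δ + 4 * m^2+4 * δ * m+4 * m-1)

/-!
With `t = sin² x`, the functions `e_0² e_m²` are, up to constants, squares of the polynomials
`p_m(t) = P_m^{(1/2, δ-3/2)}(1 - 2t)`, and `C_{00mm}` is a constant multiple of the moment
`J_m = ∫₀^{π/2} p_m(sin² x)² sin² x cos^{4δ-4} x dx`.

The recurrence is a creative telescoping identity under the integral sign. The lowering and raising
relations (`jacobiPoly_lower`, `jacobiPoly_raise`) express `p_m` and `p_{m+2}` through
`v = p_{m+1}` and `v'`, and the Jacobi equation (`jacobiPoly_ode`) eliminates `v''`. Hence any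
combination of `p_m²`, `p_{m+1}²`, `p_{m+2}²` is a quadratic form in `v, v'` with coefficients that
are polynomials in `t`. For the coefficients of the recurrence (rescaled by the ratios of the
normalization constants) this form times `sin² x cos^{4δ-4} x` is the `x`-derivative of
`sin³ x cos^{4δ-3} x (A v² + B v v' + C v'²)` with explicit `A`, `B`, `C`
(`telescoping_identity`). The boundary terms vanish (`kgMoment_eq_zero_of_exact`), which gives
`kgMoment_recurrence` and, with the ratios `N_{m+1}² / N_m²`, `kgF_recurrence`.

For the monotonicity, the recurrence holds at `m = 0` too, the inequality `f_1 < f_0` is explicit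
(`kgF_one_lt_zero`), and `Q_m < P_m + R_m` (`kgRecQ_lt`) with `f ≥ 0` propagates it:
`R_m f_{m+2} = Q_m f_{m+1} - P_m f_m < (Q_m - P_m) f_{m+1} ≤ R_m f_{m+1}`.
-/

/-! ### Jacobi polynomials in the variable `t = (1 - y) / 2` -/

open Polynomial in
/-- The Jacobi polynomial `P_n^{(1/2, d-3/2)}(y)` as a polynomial in `t = (1 - y) / 2`, which on the
interval is `t = sin² x` for `y = cos 2x`. -/
noncomputable def jacobiPoly (d : ℝ) (n : ℕ) : ℝ[X] :=
  ∑ l ∈ Finset.range (n + 1),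
    C ((-1) ^ l * ((ascPochhammer ℝ l).eval ((n : ℝ) + d) *
      (ascPochhammer ℝ (n - l)).eval ((l : ℝ) + 3 / 2) /
      ((l.factorial : ℝ) * ((n - l).factorial : ℝ)))) * X ^ l

theorem jacobiP_cos_two_mul (d : ℝ) (n : ℕ) (x : ℝ) :
    jacobiP (1 / 2) (d - 3 / 2) n (Real.cos (2 * x)) =
      (jacobiPoly d n).eval (Real.sin x ^ 2) := by
  have hx : (Real.cos (2 * x) - 1) / 2 = -(Real.sin x ^ 2) := by
    rw [Real.cos_two_mul, Real.cos_sq']; ring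
  simp only [jacobiP, jacobiPoly, Polynomial.eval_finsetSum, Polynomial.eval_mul,
    Polynomial.eval_C, Polynomial.eval_pow, Polynomial.eval_X, hx]
  refine Finset.sum_congr rfl fun l _ => ?_
  rw [show (n : ℝ) + 1 / 2 + (d - 3 / 2) + 1 = n + d by ring,
    show (1 / 2 : ℝ) + l + 1 = l + 3 / 2 by ring, neg_pow (Real.sin x ^ 2)]
  ring

theorem jacobiPoly_coeff_of_le (d : ℝ) {n l : ℕ} (h : l ≤ n) :
    (jacobiPoly d n).coeff l = (-1) ^ l * ((ascPochhammer ℝ l).eval ((n : ℝ) + d) *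
      (ascPochhammer ℝ (n - l)).eval ((l : ℝ) + 3 / 2) /
      ((l.factorial : ℝ) * ((n - l).factorial : ℝ))) := by
  simp only [jacobiPoly, Polynomial.finsetSum_coeff, Polynomial.coeff_C_mul_X_pow]
  rw [Finset.sum_ite_eq, if_pos (Finset.mem_range.2 (by omega))]

theorem jacobiPoly_coeff_of_lt (d : ℝ) {n l : ℕ} (h : n < l) :
    (jacobiPoly d n).coeff l = 0 := by
  simp only [jacobiPoly, Polynomial.finsetSum_coeff, Polynomial.coeff_C_mul_X_pow]
  rw [Finset.sum_ite_eq, if_neg (by simp; omega)]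

theorem ascPochhammer_eval_succ_left (z : ℝ) (k : ℕ) :
    (ascPochhammer ℝ (k + 1)).eval z = z * (ascPochhammer ℝ k).eval (z + 1) := by
  simp [ascPochhammer_succ_left]

/-- The hypergeometric recurrence between neighbouring coefficients of one polynomial. -/
theorem jacobiPoly_coeff_succ (d : ℝ) (n l : ℕ) :
    ((l : ℝ) + 1) * (l + 3 / 2) * (jacobiPoly d n).coeff (l + 1) =
      -((n - l) * (n + d + l)) * (jacobiPoly d n).coeff l := by
  rcases lt_trichotomy l n with h | h | h
  · obtain ⟨j, rfl⟩ := Nat.exists_eq_add_of_lt h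
    rw [jacobiPoly_coeff_of_le d (by omega), jacobiPoly_coeff_of_le d (by omega),
      show l + j + 1 - (l + 1) = j by omega, show l + j + 1 - l = j + 1 by omega,
      ascPochhammer_succ_eval, ascPochhammer_eval_succ_left _ j,
      Nat.factorial_succ, Nat.factorial_succ]
    push_cast
    rw [show (l : ℝ) + 1 + 3 / 2 = l + 3 / 2 + 1 by ring]
    have := Nat.factorial_pos l
    have := Nat.factorial_pos j
    field_simp
    ring
  · subst h
    rw [jacobiPoly_coeff_of_lt d (Nat.lt_succ_self l)]; ring
  · rw [jacobiPoly_coeff_of_lt d h, jacobiPoly_coeff_of_lt d (by omega)]; ring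

/-- Equal-index coefficients in consecutive degrees. At `l = n + 1` both sides vanish, so this says
nothing about the leading coefficient in degree `n + 1`. -/
theorem jacobiPoly_coeff_degree_succ (d : ℝ) (n l : ℕ) :
    ((n : ℝ) + d) * (n + 1 - l) * (jacobiPoly d (n + 1)).coeff l =
      (n + 3 / 2) * (n + d + l) * (jacobiPoly d n).coeff l := by
  rcases lt_trichotomy l (n + 1) with h | h | h
  · obtain ⟨j, rfl⟩ := Nat.exists_eq_add_of_le (Nat.lt_succ_iff.1 h)
    rw [jacobiPoly_coeff_of_le d (by omega), jacobiPoly_coeff_of_le d (by omega),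
      show l + j + 1 - l = j + 1 by omega, show l + j - l = j by omega,
      ascPochhammer_succ_eval, Nat.factorial_succ]
    have key := ascPochhammer_eval_succ_left ((l : ℝ) + j + d) l
    rw [ascPochhammer_succ_eval] at key
    push_cast
    rw [show (l : ℝ) + j + 1 + d = l + j + d + 1 by ring]
    have := Nat.factorial_pos l
    have := Nat.factorial_pos j
    generalize (ascPochhammer ℝ l).eval ((l : ℝ) + j + d + 1) = u1 at *
    generalize (ascPochhammer ℝ l).eval ((l : ℝ) + j + d) = u2 at *
    generalize (ascPochhammer ℝ j).eval ((l : ℝ) + 3 / 2) = u3 at *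
    field_simp
    linear_combination (-(2 * ((l : ℝ) + j) + 3) * (j + 1) * u3) * key
  · subst h
    rw [jacobiPoly_coeff_of_lt d (Nat.lt_succ_self n)]; push_cast; ring
  · rw [jacobiPoly_coeff_of_lt d h, jacobiPoly_coeff_of_lt d (by omega)]; ring

/-- This relation also covers the leading coefficients, about which
`jacobiPoly_coeff_degree_succ` says nothing. -/
theorem jacobiPoly_coeff_succ_degree_succ (d : ℝ) (n l : ℕ) :
    ((n : ℝ) + d) * (l + 1) * (l + 3 / 2) * (jacobiPoly d (n + 1)).coeff (l + 1) =
      -((n + 3 / 2) * (n + d + l) * (n + d + l + 1)) * (jacobiPoly d n).coeff l := by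
  rcases le_or_gt l n with h | h
  · obtain ⟨j, rfl⟩ := Nat.exists_eq_add_of_le h
    rw [jacobiPoly_coeff_of_le d (by omega), jacobiPoly_coeff_of_le d (by omega),
      show l + j + 1 - (l + 1) = j by omega, show l + j - l = j by omega, Nat.factorial_succ]
    have key := ascPochhammer_eval_succ_left ((l : ℝ) + j + d) (l + 1)
    rw [ascPochhammer_succ_eval, ascPochhammer_succ_eval] at key
    have key2 := ascPochhammer_eval_succ_left ((l : ℝ) + 3 / 2) j
    rw [ascPochhammer_succ_eval] at key2
    push_cast at key ⊢
    rw [show (l : ℝ) + j + 1 + d = l + j + d + 1 by ring,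
      show (l : ℝ) + 1 + 3 / 2 = l + 3 / 2 + 1 by ring]
    have := Nat.factorial_pos l
    have := Nat.factorial_pos j
    generalize (ascPochhammer ℝ (l + 1)).eval ((l : ℝ) + j + d + 1) = u1 at *
    generalize (ascPochhammer ℝ l).eval ((l : ℝ) + j + d) = u2 at *
    generalize (ascPochhammer ℝ j).eval ((l : ℝ) + 3 / 2 + 1) = u3 at *
    generalize (ascPochhammer ℝ j).eval ((l : ℝ) + 3 / 2) = u4 at *
    rw [pow_succ]
    field_simp
    linear_combination (2 * l + 3) * u3 * key +
      2 * (u2 * (l + j + d + l) * (l + j + d + (l + 1))) * key2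
  · rw [jacobiPoly_coeff_of_lt d h, jacobiPoly_coeff_of_lt d (by omega)]; ring

/-! ### Differential equation, lowering and raising relations -/

open Polynomial in
theorem coeff_X_mul_derivative {R : Type*} [CommSemiring R] (p : R[X]) (l : ℕ) :
    (X * derivative p).coeff l = l * p.coeff l := by
  cases l with
  | zero => simp
  | succ l => rw [coeff_X_mul, coeff_derivative]; push_cast; ring

open Polynomial in
/-- The Jacobi differential equation. -/
theorem jacobiPoly_ode (d : ℝ) (n : ℕ) (t : ℝ) :
    t * (1 - t) * (derivative (derivative (jacobiPoly d n))).eval t +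
      (3 / 2 - (d + 1) * t) * (derivative (jacobiPoly d n)).eval t +
      n * (n + d) * (jacobiPoly d n).eval t = 0 := by
  have h : X * derivative (derivative (jacobiPoly d n)) +
        C (3 / 2) * derivative (jacobiPoly d n) + C ((n : ℝ) * (n + d)) * jacobiPoly d n =
      X * derivative (X * derivative (jacobiPoly d n)) +
        C d * (X * derivative (jacobiPoly d n)) := by
    ext l
    simp only [coeff_add, coeff_C_mul, coeff_X_mul_derivative, coeff_derivative]
    linear_combination jacobiPoly_coeff_succ d n l
  have := congrArg (eval t) h
  simp only [eval_add, eval_mul, eval_X, eval_C, derivative_mul, derivative_X] at this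
  simp only [eval_one] at this
  linear_combination this

open Polynomial in
/-- The lowering relation: `P_m` in terms of `P_{m+1}` and its derivative. -/
theorem jacobiPoly_lower {d : ℝ} (hd : 0 < d) (m : ℕ) (t : ℝ) :
    (m + 3 / 2) * (m + d - 1 / 2) * (jacobiPoly d m).eval t =
      (m + 1) * (m + d - 1 / 2 - (2 * m + d + 1) * t) * (jacobiPoly d (m + 1)).eval t -
      (2 * m + d + 1) * (t * (1 - t)) * (derivative (jacobiPoly d (m + 1))).eval t := by
  have h : C (((m : ℝ) + 3 / 2) * (m + d - 1 / 2)) * jacobiPoly d m =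
      C (((m : ℝ) + 1) * (m + d - 1 / 2)) * jacobiPoly d (m + 1) -
      C (((m : ℝ) + 1) * (2 * m + d + 1)) * (X * jacobiPoly d (m + 1)) -
      C (2 * (m : ℝ) + d + 1) * (X * derivative (jacobiPoly d (m + 1))) +
      C (2 * (m : ℝ) + d + 1) * (X * (X * derivative (jacobiPoly d (m + 1)))) := by
    ext l
    have h1 := jacobiPoly_coeff_degree_succ d m l
    have hne : (m : ℝ) + d + l ≠ 0 := by positivity
    -- The factor that makes `h1` express the coefficient of `P_m` by that of `P_{m+1}`.
    apply mul_left_cancel₀ hne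
    cases l with
    | zero =>
      simp only [coeff_add, coeff_sub, coeff_C_mul, coeff_X_mul_zero]
      push_cast at h1 ⊢
      linear_combination (-((m : ℝ) + d - 1 / 2)) * h1
    | succ l =>
      have h2 := jacobiPoly_coeff_succ d (m + 1) l
      simp only [coeff_add, coeff_sub, coeff_C_mul, coeff_X_mul_derivative, coeff_X_mul,
        coeff_derivative]
      push_cast at h1 h2 ⊢
      linear_combination (-((m : ℝ) + d - 1 / 2)) * h1 + (2 * (m : ℝ) + d + 1) * h2
  have := congrArg (eval t) h
  simp only [eval_add, eval_sub, eval_mul, eval_X, eval_C] at this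
  linear_combination this

open Polynomial in
/-- The raising relation: `P_{n+1}` in terms of `P_n` and its derivative. -/
theorem jacobiPoly_raise {d : ℝ} (hd : 0 < d) (n : ℕ) (t : ℝ) :
    (n + 1) * (n + d) * (jacobiPoly d (n + 1)).eval t =
      (n + d) * (n + 3 / 2 - (2 * n + d + 1) * t) * (jacobiPoly d n).eval t +
      (2 * n + d + 1) * (t * (1 - t)) * (derivative (jacobiPoly d n)).eval t := by
  have h : C (((n : ℝ) + 1) * (n + d)) * jacobiPoly d (n + 1) =
      C (((n : ℝ) + d) * (n + 3 / 2)) * jacobiPoly d n -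
      C (((n : ℝ) + d) * (2 * n + d + 1)) * (X * jacobiPoly d n) +
      C (2 * (n : ℝ) + d + 1) * (X * derivative (jacobiPoly d n)) -
      C (2 * (n : ℝ) + d + 1) * (X * (X * derivative (jacobiPoly d n))) := by
    ext l
    cases l with
    | zero =>
      have h1 := jacobiPoly_coeff_degree_succ d n 0
      simp only [coeff_add, coeff_sub, coeff_C_mul, coeff_X_mul_zero]
      have hne : (n : ℝ) + d ≠ 0 := by positivity
      push_cast at h1 ⊢
      linear_combination h1
    | succ l =>
      have h1 := jacobiPoly_coeff_succ_degree_succ d n l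
      have h2 := jacobiPoly_coeff_succ d n l
      have hne : ((l : ℝ) + 1) * (l + 3 / 2) ≠ 0 := by positivity
      apply mul_left_cancel₀ hne
      simp only [coeff_add, coeff_sub, coeff_C_mul, coeff_X_mul_derivative, coeff_X_mul,
        coeff_derivative]
      linear_combination (n + 1) * h1 - ((n + d) * (n + 3 / 2) + (2 * n + d + 1) * (l + 1)) * h2
  have := congrArg (eval t) h
  simp only [eval_add, eval_sub, eval_mul, eval_X, eval_C] at this
  linear_combination this

/-! ### The moment functional and integration by parts -/

open Polynomial in
/-- The moment functional `q ↦ ∫₀^{π/2} q(sin² x) sin² x cos^{4δ-4} x dx`, which computes the Fourier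
coefficients `C_{00mm}`. -/
noncomputable def kgMoment (δ : ℕ) (q : ℝ[X]) : ℝ :=
  ∫ x in (0 : ℝ)..(Real.pi / 2),
    q.eval (Real.sin x ^ 2) * (Real.sin x ^ 2 * Real.cos x ^ (4 * δ - 4))

theorem intervalIntegrable_kgMoment (δ : ℕ) (q : Polynomial ℝ) :
    IntervalIntegrable
      (fun x => q.eval (Real.sin x ^ 2) * (Real.sin x ^ 2 * Real.cos x ^ (4 * δ - 4)))
      MeasureTheory.volume 0 (Real.pi / 2) := by
  have := q.continuous
  apply Continuous.intervalIntegrable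
  fun_prop

theorem kgMoment_add (δ : ℕ) (p q : Polynomial ℝ) :
    kgMoment δ (p + q) = kgMoment δ p + kgMoment δ q := by
  simp only [kgMoment, Polynomial.eval_add, add_mul]
  exact intervalIntegral.integral_add (intervalIntegrable_kgMoment δ p)
    (intervalIntegrable_kgMoment δ q)

theorem kgMoment_C_mul (δ : ℕ) (a : ℝ) (q : Polynomial ℝ) :
    kgMoment δ (Polynomial.C a * q) = a * kgMoment δ q := by
  simp only [kgMoment, Polynomial.eval_mul, Polynomial.eval_C, mul_assoc]
  exact intervalIntegral.integral_const_mul a _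

theorem kgMoment_sq_nonneg (δ : ℕ) (q : Polynomial ℝ) : 0 ≤ kgMoment δ (q ^ 2) := by
  refine intervalIntegral.integral_nonneg (by positivity) fun x hx => ?_
  have : 0 ≤ Real.cos x := Real.cos_nonneg_of_mem_Icc ⟨by linarith [hx.1, Real.pi_pos], hx.2⟩
  rw [Polynomial.eval_pow]
  positivity

theorem kgMoment_one_pos (δ : ℕ) : 0 < kgMoment δ 1 := by
  refine intervalIntegral.intervalIntegral_pos_of_pos_on (intervalIntegrable_kgMoment δ 1)
    (fun x hx => ?_) (by positivity)
  have hc : 0 < Real.cos x := Real.cos_pos_of_mem_Ioo ⟨by linarith [hx.1, Real.pi_pos], hx.2⟩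
  have hs : 0 < Real.sin x := Real.sin_pos_of_pos_of_lt_pi hx.1 (by linarith [hx.2, Real.pi_pos])
  rw [Polynomial.eval_one]
  positivity

open Polynomial in
/-- Integration by parts: the integrand is the derivative of
`sin³ x cos^{4δ-3} x G(sin² x)`, which vanishes at both ends of the interval. -/
theorem kgMoment_eq_zero_of_exact {δ : ℕ} (hδ : 1 ≤ δ) {q G : ℝ[X]}
    (h : ∀ t, q.eval t =
      (3 - 4 * δ * t) * G.eval t + 2 * (t * (1 - t)) * (derivative G).eval t) :
    kgMoment δ q = 0 := by
  obtain ⟨k, rfl⟩ := Nat.exists_eq_add_of_le hδ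
  have hderiv : ∀ x : ℝ, HasDerivAt
      (fun x => Real.sin x ^ 3 * Real.cos x ^ (4 * k + 1) * G.eval (Real.sin x ^ 2))
      (q.eval (Real.sin x ^ 2) * (Real.sin x ^ 2 * Real.cos x ^ (4 * (1 + k) - 4))) x := by
    intro x
    have hG : HasDerivAt (fun x => G.eval (Real.sin x ^ 2)) _ x :=
      HasDerivAt.comp (h := fun x => Real.sin x ^ 2) x (G.hasDerivAt (Real.sin x ^ 2))
        ((Real.hasDerivAt_sin x).fun_pow 2)
    refine ((((Real.hasDerivAt_sin x).fun_pow 3).fun_mul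
      ((Real.hasDerivAt_cos x).fun_pow (4 * k + 1))).fun_mul hG).congr_deriv ?_
    rw [h, show 4 * (1 + k) - 4 = 4 * k by omega, ← Real.cos_sq']
    simp only [Nat.add_sub_cancel]
    push_cast
    linear_combination (3 * G.eval (Real.sin x ^ 2) * Real.sin x ^ 2 * Real.cos x ^ (4 * k)) *
      Real.sin_sq_add_cos_sq x
  have hint := intervalIntegral.integral_eq_sub_of_hasDerivAt
    (a := 0) (b := Real.pi / 2) (fun x _ => hderiv x) (intervalIntegrable_kgMoment (1 + k) q)
  rw [kgMoment, hint]
  simp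

/-! ### The telescoping identity -/

/-- The middle coefficient `Q_m` of the recurrence without its factor `ω_{m+1}²`. -/
def kgRecQReduced (d m : ℝ) : ℝ :=
  315 * d^5+728 * d^4+914 * d^3+418 * d^2-41 * d + 832 * d^2 * m^6+704 *
    d^3 * m^5 + 5760 * d^2 * m^5+320 * d^4 * m^4+4432 * d^3 * m^4+15432 * d^2 * m^4+64 * d^5 *
    m^3+1824 * d^4 * m^3+10352 * d^3 * m^3 + 20224 * d^2 * m^3 + 336 * d^5 * m^2+3620 * d^4 *
    m^2+11064 * d^3 * m^2+13402 * d^2 * m^2+512 * d * m^7+3840 * d * m^6 + 11424 * d * m^5+17168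
    * d * m^4+13616 * d * m^3+5280 * d * m^2+128 * m^8+1024 * m^7+3296 * m^6+5440 * m^5 + 4792 *
    m^4+2016 * m^3+154 * m^2+572 * d^5 * m+2880 * d^4 * m+5330 * d^3 * m+4100 * d^2 * m+698 * d
    * m - 140 * m-30

theorem kgRecQ_eq (d m : ℝ) : kgRecQ d m = (d + 2 * m + 2) ^ 2 * kgRecQReduced d m := rfl

/-- The common factor of the coefficients `A`, `B`, `C` of the boundary term. With it taken out,
`A = a₀ + a₁ t`, `B = (1 - t) (b₀ + b₁ t)` and `C = 2 b₀ t (1 - t)²`. -/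
def boundaryFactor (d m : ℝ) : ℝ := (2 * m + d + 1) * (2 * m + d + 2) * (2 * m + d + 3)

/-- The coefficient `a₀` of the boundary term, see `boundaryFactor`. -/
def boundaryA₀ (d m : ℝ) : ℝ :=
  16 + 60 * d + 216 * d ^ 2 + 220 * d ^ 3 + (160 + 432 * d + 688 * d ^ 2 + 256 * d ^ 3) * m +
    (336 + 688 * d + 576 * d ^ 2 + 64 * d ^ 3) * m ^ 2 + (256 + 384 * d + 128 * d ^ 2) * m ^ 3 +
    (64 + 64 * d) * m ^ 4

/-- The coefficient `a₁` of the boundary term, see `boundaryFactor`. -/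
def boundaryA₁ (d m : ℝ) : ℝ :=
  80 + 48 * d - 256 * d ^ 2 - 304 * d ^ 3 - 80 * d ^ 4 +
    (288 - 176 * d - 1024 * d ^ 2 - 560 * d ^ 3 - 64 * d ^ 4) * m +
    (400 - 672 * d - 1136 * d ^ 2 - 256 * d ^ 3) * m ^ 2 + (256 - 640 * d - 384 * d ^ 2) * m ^ 3 +
    (64 - 192 * d) * m ^ 4

/-- The coefficient `b₁` of the boundary term, see `boundaryFactor`. -/
def boundaryB₁ (d m : ℝ) : ℝ :=
  64 + 352 * d + 448 * d ^ 2 + 160 * d ^ 3 + (640 + 1472 * d + 832 * d ^ 2 + 128 * d ^ 3) * m +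
    (1344 + 1600 * d + 384 * d ^ 2) * m ^ 2 + (1024 + 512 * d) * m ^ 3 + 256 * m ^ 4

/-- The coefficient `b₀` of the boundary term, see `boundaryFactor`. -/
def boundaryB₀ (d m : ℝ) : ℝ :=
  -8 * (d - 1) * (5 + 5 * d + 8 * m + 4 * d * m + 4 * m ^ 2)

set_option maxRecDepth 8000 in
/-- The telescoping identity, pointwise in `t`, for any `v, v', v''` satisfying the Jacobi equation of
degree `m + 1`. The two squared linear forms in `v, v'` on the left are the right-hand sides of the
lowering and raising relations; the right-hand side is `(3 - 4dt) G + 2t(1-t) dG/dt` for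
`G = A v² + B v v' + C v'²`. -/
theorem telescoping_identity (d m t v v' v'' : ℝ)
    (ode : t * (1 - t) * v'' + (3 / 2 - (d + 1) * t) * v' + (m + 1) * (m + 1 + d) * v = 0) :
    32 * ((m + 1) * (2 * m + 1) * (d + 2 * m + 3) * (9 * d + 4 * m^2 + 4 * d * m+12 * m+7)) *
        ((m + 1) * (m + d - 1 / 2 - (2 * m + d + 1) * t) * v -
          (2 * m + d + 1) * (t * (1 - t)) * v') ^ 2 -
      4 * ((2 * m + d + 2) * kgRecQReduced d m) * v ^ 2 +
      32 * ((d + m + 1) * (2 * m + d + 1) * (2 * d + 2 * m + 3) *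
          (5 * d + 4 * m^2 + 4 * d * m+4 * m-1)) *
        ((m + 1 + d) * (m + 5 / 2 - (2 * m + d + 3) * t) * v +
          (2 * m + d + 3) * (t * (1 - t)) * v') ^ 2 =
    boundaryFactor d m * ((3 - 4 * d * t) *
        ((boundaryA₀ d m + boundaryA₁ d m * t) * v ^ 2 +
          (1 - t) * (boundaryB₀ d m + boundaryB₁ d m * t) * v * v' +
          2 * boundaryB₀ d m * t * (1 - t) ^ 2 * v' ^ 2) +
      2 * (t * (1 - t)) *
        (boundaryA₁ d m * v ^ 2 + (boundaryA₀ d m + boundaryA₁ d m * t) * (2 * v * v') +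
          ((1 - t) * boundaryB₁ d m - (boundaryB₀ d m + boundaryB₁ d m * t)) * v * v' +
          (1 - t) * (boundaryB₀ d m + boundaryB₁ d m * t) * (v' ^ 2 + v * v'') +
          2 * boundaryB₀ d m * ((1 - t) ^ 2 - 2 * t * (1 - t)) * v' ^ 2 +
          2 * boundaryB₀ d m * t * (1 - t) ^ 2 * (2 * v' * v''))) := by
  linear_combination (norm := skip)
    (-boundaryFactor d m * (2 * ((1 - t) * (boundaryB₀ d m + boundaryB₁ d m * t)) * v +
      8 * boundaryB₀ d m * t * (1 - t) ^ 2 * v')) * ode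
  unfold boundaryFactor boundaryA₀ boundaryA₁ boundaryB₀ boundaryB₁ kgRecQReduced
  ring1

open Polynomial in
/-- The recurrence for the moments `J_m` alone, with the normalization constants stripped off. The
squared factors are those multiplying `p_m` and `p_{m+2}` in the lowering and raising relations. -/
theorem kgMoment_recurrence {δ : ℕ} (hδ : 1 ≤ δ) (m : ℕ) :
    32 * (((m : ℝ) + 1) * (2 * m + 1) * (δ + 2 * m + 3) *
        (9 * δ + 4 * m ^ 2 + 4 * δ * m + 12 * m + 7)) *
        ((m + 3 / 2) * (m + δ - 1 / 2)) ^ 2 * kgMoment δ (jacobiPoly δ m ^ 2) -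
      4 * ((2 * m + δ + 2) * kgRecQReduced δ m) * kgMoment δ (jacobiPoly δ (m + 1) ^ 2) +
      32 * (((δ : ℝ) + m + 1) * (2 * m + δ + 1) * (2 * δ + 2 * m + 3) *
        (5 * δ + 4 * m ^ 2 + 4 * δ * m + 4 * m - 1)) *
        ((m + 2) * (m + 1 + δ)) ^ 2 * kgMoment δ (jacobiPoly δ (m + 2) ^ 2) = 0 := by
  have hd : (0 : ℝ) < δ := by exact_mod_cast hδ
  set v := jacobiPoly δ (m + 1) with hv
  have key := kgMoment_eq_zero_of_exact hδ
    (q := C (32 * (((m : ℝ) + 1) * (2 * m + 1) * (δ + 2 * m + 3) *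
        (9 * δ + 4 * m ^ 2 + 4 * δ * m + 12 * m + 7)) *
        ((m + 3 / 2) * (m + δ - 1 / 2)) ^ 2) * jacobiPoly δ m ^ 2 +
      (C (-(4 * ((2 * m + δ + 2) * kgRecQReduced δ m))) * v ^ 2 +
      C (32 * (((δ : ℝ) + m + 1) * (2 * m + δ + 1) * (2 * δ + 2 * m + 3) *
        (5 * δ + 4 * m ^ 2 + 4 * δ * m + 4 * m - 1)) *
        ((m + 2) * (m + 1 + δ)) ^ 2) * jacobiPoly δ (m + 2) ^ 2))
    (G := C (boundaryFactor δ m) * ((C (boundaryA₀ δ m) + C (boundaryA₁ δ m) * X) * v ^ 2 +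
      (1 - X) * (C (boundaryB₀ δ m) + C (boundaryB₁ δ m) * X) * v * derivative v +
      C (2 * boundaryB₀ δ m) * X * (1 - X) ^ 2 * derivative v ^ 2)) ?_
  · rw [kgMoment_add, kgMoment_add, kgMoment_C_mul, kgMoment_C_mul, kgMoment_C_mul] at key
    linear_combination key
  · intro t
    have ode := jacobiPoly_ode δ (m + 1) t
    have low := jacobiPoly_lower hd m t
    have raise := jacobiPoly_raise hd (m + 1) t
    rw [← hv] at ode low raise
    push_cast at ode raise
    have cert := telescoping_identity δ m t (v.eval t) ((derivative v).eval t)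
      ((derivative (derivative v)).eval t) ode
    have low2 := congrArg (· ^ 2) low
    have raise2 := congrArg (· ^ 2) raise
    simp only [eval_add, eval_sub, eval_mul, eval_pow, eval_X, eval_C, eval_one, derivative_add,
      derivative_sub, derivative_mul, derivative_pow, derivative_X, derivative_C, derivative_one,
      eval_zero, Nat.cast_ofNat, eval_ofNat, map_ofNat]
    rw [show m + 2 = m + 1 + 1 from rfl]
    linear_combination cert + 32 * (((m : ℝ) + 1) * (2 * m + 1) * (δ + 2 * m + 3) *
        (9 * δ + 4 * m ^ 2 + 4 * δ * m + 12 * m + 7)) * low2 +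
      32 * (((δ : ℝ) + m + 1) * (2 * m + δ + 1) * (2 * δ + 2 * m + 3) *
        (5 * δ + 4 * m ^ 2 + 4 * δ * m + 4 * m - 1)) * raise2

/-! ### Normalization constants and Fourier coefficients -/

/-- All four Gamma values are positive, so the square root is genuine. -/
theorem kgN_sq {d : ℝ} (hd : 2 ≤ d) (n : ℕ) :
    kgN d n ^ 2 = 2 * Real.Gamma ((n : ℝ) + 1) / Real.Gamma ((n : ℝ) + 3 / 2) *
      ((2 * (n : ℝ) + d) * Real.Gamma ((n : ℝ) + d) / Real.Gamma ((n : ℝ) + d - 1 / 2)) := by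
  have hn : (0 : ℝ) ≤ n := n.cast_nonneg
  have h1 : 0 < Real.Gamma ((n : ℝ) + 1) := Real.Gamma_pos_of_pos (by positivity)
  have h2 : 0 < Real.Gamma ((n : ℝ) + 3 / 2) := Real.Gamma_pos_of_pos (by positivity)
  have h3 : 0 < Real.Gamma ((n : ℝ) + d) := Real.Gamma_pos_of_pos (by linarith)
  have h4 : 0 < Real.Gamma ((n : ℝ) + d - 1 / 2) := Real.Gamma_pos_of_pos (by linarith)
  rw [kgN, Real.sq_sqrt (by positivity)]

theorem kgN_sq_pos {d : ℝ} (hd : 2 ≤ d) (n : ℕ) : 0 < kgN d n ^ 2 := by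
  have hn : (0 : ℝ) ≤ n := n.cast_nonneg
  have h1 : 0 < Real.Gamma ((n : ℝ) + 1) := Real.Gamma_pos_of_pos (by positivity)
  have h2 : 0 < Real.Gamma ((n : ℝ) + 3 / 2) := Real.Gamma_pos_of_pos (by positivity)
  have h3 : 0 < Real.Gamma ((n : ℝ) + d) := Real.Gamma_pos_of_pos (by linarith)
  have h4 : 0 < Real.Gamma ((n : ℝ) + d - 1 / 2) := Real.Gamma_pos_of_pos (by linarith)
  rw [kgN_sq hd]
  positivity

theorem kgN_sq_succ {d : ℝ} (hd : 2 ≤ d) (n : ℕ) :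
    kgN d (n + 1) ^ 2 = kgN d n ^ 2 * ((n + 1) * (n + d) * (2 * n + d + 2) /
      ((n + 3 / 2) * (n + d - 1 / 2) * (2 * n + d))) := by
  have hn : (0 : ℝ) ≤ n := n.cast_nonneg
  have h1 : 0 < Real.Gamma ((n : ℝ) + 1) := Real.Gamma_pos_of_pos (by positivity)
  have h2 : 0 < Real.Gamma ((n : ℝ) + 3 / 2) := Real.Gamma_pos_of_pos (by positivity)
  have h3 : 0 < Real.Gamma ((n : ℝ) + d) := Real.Gamma_pos_of_pos (by linarith)
  have h4 : 0 < Real.Gamma ((n : ℝ) + d - 1 / 2) := Real.Gamma_pos_of_pos (by linarith)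
  have p1 : (0 : ℝ) < n + 1 := by linarith
  have p2 : (0 : ℝ) < n + 3 / 2 := by linarith
  have p3 : (0 : ℝ) < n + d := by linarith
  have p4 : (0 : ℝ) < n + d - 1 / 2 := by linarith
  have p5 : (0 : ℝ) < 2 * n + d := by linarith
  rw [kgN_sq hd, kgN_sq hd]
  push_cast
  rw [Real.Gamma_add_one p1.ne', show (n : ℝ) + 1 + 3 / 2 = n + 3 / 2 + 1 by ring,
    Real.Gamma_add_one p2.ne', show (n : ℝ) + 1 + d = n + d + 1 by ring,
    Real.Gamma_add_one p3.ne', show (n : ℝ) + d + 1 - 1 / 2 = n + d - 1 / 2 + 1 by ring,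
    Real.Gamma_add_one p4.ne']
  generalize Real.Gamma ((n : ℝ) + 1) = g1 at *
  generalize Real.Gamma ((n : ℝ) + 3 / 2) = g2 at *
  generalize Real.Gamma ((n : ℝ) + d) = g3 at *
  generalize Real.Gamma ((n : ℝ) + d - 1 / 2) = g4 at *
  rw [div_mul_div_comm, div_mul_div_comm, div_mul_div_comm, div_eq_div_iff (by positivity)
    (by positivity)]
  ring

theorem jacobiPoly_zero (d : ℝ) : jacobiPoly d 0 = 1 := by
  simp [jacobiPoly]

theorem kgC_zero_zero_eq (δ : ℕ) (hδ : 1 ≤ δ) (m : ℕ) :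
    kgC δ 0 0 m m = kgN δ 0 ^ 2 * kgN δ m ^ 2 * kgMoment δ (jacobiPoly δ m ^ 2) := by
  have hexp : 2 * (δ : ℝ) - 2 = ((2 * δ - 2 : ℕ) : ℝ) := by
    rw [Nat.cast_sub (by omega)]; push_cast; ring
  rw [kgC, kgMoment, ← intervalIntegral.integral_const_mul]
  refine intervalIntegral.integral_congr fun x _ => ?_
  simp only [kgW, kgE, kgWeight, jacobiP_cos_two_mul, jacobiPoly_zero, Polynomial.eval_one,
    Polynomial.eval_pow, hexp, Real.rpow_natCast]
  rw [show 4 * δ - 4 = (2 * δ - 2) + (2 * δ - 2) by omega, pow_add]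
  ring

theorem kgF_eq (δ : ℕ) (hδ : 1 ≤ δ) (m : ℕ) :
    kgF δ m = kgN δ 0 ^ 2 * kgN δ m ^ 2 * kgMoment δ (jacobiPoly δ m ^ 2) /
      (2 * m + δ) ^ 2 := by
  rw [kgF, kgC_zero_zero_eq δ hδ, kgOmega]

theorem kgF_recurrence {δ : ℕ} (hδ : 2 ≤ δ) (m : ℕ) :
    kgRecP δ m * kgF δ m - kgRecQ δ m * kgF δ (m + 1) + kgRecR δ m * kgF δ (m + 2) = 0 := by
  have hd : (2 : ℝ) ≤ δ := by exact_mod_cast hδ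
  have hm : (0 : ℝ) ≤ m := m.cast_nonneg
  have h := kgMoment_recurrence (by omega : 1 ≤ δ) m
  rw [kgF_eq δ (by omega), kgF_eq δ (by omega), kgF_eq δ (by omega),
    show m + 2 = m + 1 + 1 from rfl, kgN_sq_succ hd (m + 1), kgN_sq_succ hd m, kgRecQ_eq]
  rw [show m + 2 = m + 1 + 1 from rfl] at h
  push_cast
  unfold kgRecP kgRecR
  generalize kgMoment δ (jacobiPoly δ m ^ 2) = J₀ at *
  generalize kgMoment δ (jacobiPoly δ (m + 1) ^ 2) = J₁ at *
  generalize kgMoment δ (jacobiPoly δ (m + 1 + 1) ^ 2) = J₂ at *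
  generalize kgRecQReduced (δ : ℝ) m = q at *
  generalize kgN (δ : ℝ) 0 ^ 2 = c at *
  generalize kgN (δ : ℝ) m ^ 2 = e at *
  generalize (δ : ℝ) = d at *
  generalize (m : ℝ) = x at *
  -- Up to the common factor `k`, the three terms are those of the recurrence for the moments.
  have p2 : 0 < x + 3 / 2 := by linarith
  have p4 : 0 < x + d - 1 / 2 := by linarith
  have p5 : 0 < 2 * x + d := by linarith
  have p6 : 0 < x + 1 + 3 / 2 := by linarith
  have p7 : 0 < x + 1 + d - 1 / 2 := by linarith
  have p8 : 0 < 2 * (x + 1) + d := by linarith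
  have p9 : 0 < 2 * (x + 1 + 1) + d := by linarith
  set k := (x + 1) * (x + d) / (4 * (2 * x + d) * ((x + 3 / 2) * (x + d - 1 / 2))) with hk
  have q1 : 2 * (x + 1) ^ 2 * (2 * x + 1) * (2 * x + 3) * (d + x) * (d + 2 * x) *
      (d + 2 * x + 3) * (2 * d + 2 * x - 1) * (9 * d + 4 * x ^ 2 + 4 * d * x + 12 * x + 7) /
      (2 * x + d) ^ 2 = k * (32 * ((x + 1) * (2 * x + 1) * (d + 2 * x + 3) *
        (9 * d + 4 * x ^ 2 + 4 * d * x + 12 * x + 7)) *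
        ((x + 3 / 2) * (x + d - 1 / 2)) ^ 2) := by
    rw [hk, div_mul_eq_mul_div, div_eq_div_iff (by positivity) (by positivity)]
    ring
  have q2 : (d + 2 * x + 2) ^ 2 * ((x + 1) * (x + d) * (2 * x + d + 2) /
      ((x + 3 / 2) * (x + d - 1 / 2) * (2 * x + d))) / (2 * (x + 1) + d) ^ 2 =
      k * (4 * (2 * x + d + 2)) := by
    rw [hk, mul_div_assoc', div_div, div_mul_eq_mul_div,
      div_eq_div_iff (by positivity) (by positivity)]
    ring
  have q3 : 2 * (x + 2) * (2 * x + 5) * (d + x + 1) ^ 2 * (d + 2 * x + 1) * (d + 2 * x + 4) *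
      (2 * d + 2 * x + 1) * (2 * d + 2 * x + 3) * (5 * d + 4 * x ^ 2 + 4 * d * x + 4 * x - 1) *
      ((x + 1) * (x + d) * (2 * x + d + 2) / ((x + 3 / 2) * (x + d - 1 / 2) * (2 * x + d)) *
        ((x + 1 + 1) * (x + 1 + d) * (2 * (x + 1) + d + 2) /
          ((x + 1 + 3 / 2) * (x + 1 + d - 1 / 2) * (2 * (x + 1) + d)))) /
      (2 * (x + 1 + 1) + d) ^ 2 =
      k * (32 * ((d + x + 1) * (2 * x + d + 1) * (2 * d + 2 * x + 3) *
        (5 * d + 4 * x ^ 2 + 4 * d * x + 4 * x - 1)) * ((x + 2) * (x + 1 + d)) ^ 2) := by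
    rw [hk, div_mul_div_comm, mul_div_assoc', div_div, div_mul_eq_mul_div,
      div_eq_div_iff (by positivity) (by positivity)]
    ring
  clear_value k
  linear_combination c * e * (J₀ * q1 - q * J₁ * q2 + J₂ * q3 + k * h)

/-! ### Monotonicity -/

theorem kgF_nonneg {δ : ℕ} (hδ : 1 ≤ δ) (m : ℕ) : 0 ≤ kgF δ m := by
  rw [kgF_eq δ hδ]
  have := kgMoment_sq_nonneg δ (jacobiPoly δ m)
  positivity

open Polynomial in
theorem jacobiPoly_one (d : ℝ) : jacobiPoly d 1 = C (3 / 2) - C (d + 1) * X := by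
  simp [jacobiPoly, Finset.sum_range_succ, ascPochhammer_one]
  ring

open Polynomial in
theorem kgMoment_jacobiPoly_one_sq {δ : ℕ} (hδ : 1 ≤ δ) :
    kgMoment δ (jacobiPoly δ 1 ^ 2) =
      (15 * δ ^ 2 - 6 * δ - 3) / (8 * δ * (2 * δ + 1)) * kgMoment δ 1 := by
  have hd : (0 : ℝ) < δ := by exact_mod_cast hδ
  -- The square minus `κ` is exact, with a potential `g₀ + g₁ t` found by comparing coefficients.
  set κ : ℝ := (15 * δ ^ 2 - 6 * δ - 3) / (8 * δ * (2 * δ + 1)) with hκ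
  set g₁ : ℝ := -(δ + 1) ^ 2 / (4 * δ + 2) with hg₁
  set g₀ : ℝ := (5 * g₁ + 3 * (δ + 1)) / (4 * δ) with hg₀
  have key := kgMoment_eq_zero_of_exact hδ (q := jacobiPoly δ 1 ^ 2 + C (-κ) * 1)
    (G := C g₀ + C g₁ * X) ?_
  · rw [kgMoment_add, kgMoment_C_mul] at key
    linear_combination key
  · intro t
    have e1 : g₁ * (4 * δ + 2) = -(δ + 1) ^ 2 := by rw [hg₁]; field_simp
    have e0 : g₀ * (4 * δ) = 5 * g₁ + 3 * (δ + 1) := by rw [hg₀]; field_simp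
    have ec : 9 / 4 - κ = 3 * g₀ := by
      rw [hg₀, hg₁, hκ]; field_simp; ring
    rw [jacobiPoly_one]
    simp only [eval_add, eval_sub, eval_mul, eval_pow, eval_X, eval_C, eval_one, derivative_add,
      derivative_mul, derivative_X, derivative_C, eval_zero]
    linear_combination ec + t ^ 2 * e1 + t * e0

theorem kgF_one_lt_zero {δ : ℕ} (hδ : 2 ≤ δ) : kgF δ 1 < kgF δ 0 := by
  have hd : (2 : ℝ) ≤ δ := by exact_mod_cast hδ
  have hJ := kgMoment_one_pos δ
  have hN := kgN_sq_pos hd 0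
  rw [kgF_eq δ (by omega), kgF_eq δ (by omega), kgMoment_jacobiPoly_one_sq (by omega),
    kgN_sq_succ hd 0, jacobiPoly_zero, one_pow]
  push_cast
  generalize kgMoment δ 1 = J at *
  generalize kgN (δ : ℝ) 0 ^ 2 = c at *
  generalize (δ : ℝ) = d at *
  have h1 : 0 < d - 1 / 2 := by linarith
  have h2 : 0 < 2 * d - 1 := by linarith
  have e1 : c * (c * ((0 + 1) * (0 + d) * (2 * 0 + d + 2) /
      ((0 + 3 / 2) * (0 + d - 1 / 2) * (2 * 0 + d)))) *
      ((15 * d ^ 2 - 6 * d - 3) / (8 * d * (2 * d + 1)) * J) / (2 * 1 + d) ^ 2 =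
      c * c * J * ((d * (5 * d ^ 2 - 2 * d - 1)) /
        (2 * (2 * d - 1) * (2 * d + 1) * (d + 2) * d ^ 2)) := by
    have h3 : 2 * d - 1 ≠ 0 := h2.ne'
    rw [show (0 : ℝ) + d - 1 / 2 = (2 * d - 1) / 2 by ring]
    field_simp
    ring
  have e2 : c * c * J / (2 * 0 + d) ^ 2 = c * c * J * (1 / d ^ 2) := by
    rw [mul_zero, zero_add]; ring
  rw [e1, e2]
  refine mul_lt_mul_of_pos_left ?_ (by positivity)
  rw [div_lt_div_iff₀ (by positivity) (by positivity)]
  have : 0 < d ^ 2 * (2 * (2 * d - 1) * (2 * d + 1) * (d + 2) - d * (5 * d ^ 2 - 2 * d - 1)) := by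
    have : 0 < 2 * (2 * d - 1) * (2 * d + 1) * (d + 2) - d * (5 * d ^ 2 - 2 * d - 1) := by
      obtain ⟨s, rfl⟩ : ∃ s, d = s + 2 := ⟨d - 2, by ring⟩
      have : 0 ≤ s := by linarith
      ring_nf
      positivity
    positivity
  linarith

/-- In `m` and `s = d - 2` the difference of the two sides has only nonnegative coefficients. -/
theorem kgRecQ_lt {d m : ℝ} (hd : 2 ≤ d) (hm : 0 ≤ m) :
    kgRecQ d m < kgRecP d m + kgRecR d m := by
  rw [← sub_pos]
  obtain ⟨s, rfl⟩ : ∃ s, d = s + 2 := ⟨d - 2, by ring⟩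
  have hs : 0 ≤ s := by linarith
  unfold kgRecP kgRecQ kgRecR
  ring_nf
  positivity

theorem kgF_strictAnti {δ : ℕ} (hδ : 2 ≤ δ) : StrictAnti (fun m : ℕ => kgF δ m) := by
  have hd : (2 : ℝ) ≤ δ := by exact_mod_cast hδ
  refine strictAnti_nat_of_succ_lt fun n => ?_
  induction n with
  | zero => exact kgF_one_lt_zero hδ
  | succ m ih =>
    have hm : (0 : ℝ) ≤ m := m.cast_nonneg
    have hP : 0 < kgRecP δ m := by
      unfold kgRecP
      have : (0 : ℝ) < 2 * δ + 2 * m - 1 := by linarith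
      positivity
    have hR : 0 < kgRecR δ m := by
      unfold kgRecR
      have : (0 : ℝ) < 5 * δ + 4 * m ^ 2 + 4 * δ * m + 4 * m - 1 := by
        have : (0 : ℝ) ≤ 4 * m ^ 2 + 4 * δ * m := by positivity
        linarith
      positivity
    have hrec := kgF_recurrence hδ m
    have hQ := kgRecQ_lt hd hm
    have h0 := kgF_nonneg (by omega : 1 ≤ δ) (m + 1)
    -- `R f_{m+2} = Q f_{m+1} - P f_m < (Q - P) f_{m+1} ≤ R f_{m+1}`
    refine lt_of_mul_lt_mul_left ?_ hR.le
    have h1 := mul_lt_mul_of_pos_left ih hP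
    have h2 := mul_le_mul_of_nonneg_right hQ.le h0
    linarith

theorem mainTheorem4 (δ : ℕ) (hδ : 2 ≤ δ) :
    (∀ m : ℕ, 1 ≤ m →
      kgRecP (δ : ℝ) (m : ℝ) * kgF (δ : ℝ) m - kgRecQ (δ : ℝ) (m : ℝ) * kgF (δ : ℝ) (m + 1) +
        kgRecR (δ : ℝ) (m : ℝ) * kgF (δ : ℝ) (m + 2) = 0) ∧
    StrictAntiOn (fun m : ℕ => kgF (δ : ℝ) m) (Set.Ici 1) :=
  ⟨fun m _ => kgF_recurrence hδ m, (kgF_strictAnti hδ).strictAntiOn _⟩
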